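/- For real $q$ with $|q|<1$ let $$\varphi(q)=\sum_{n=-\infty}^{\infty}q^{n^2},\qquad \psi(q)=\sum_{n=0}^{\infty}q^{n(n+1)/2},$$ and for positive real numbers $k$ and $n$ define $$A_{k,n}=\frac{\varphi(-q)}{2k^{1/4}q^{k/4}\psi(q^{2k})},\qquad q=e^{-\pi\sqrt{n/k}}.$$ Then, with $a=\sqrt{1+\sqrt2}$, \begin{align*} A_{4,2}&=1+\sqrt{1+\sqrt 2},\\ A_{4,3}&=\frac{(1+\sqrt{2})(1+\sqrt{3})}{\sqrt 2},\\ A_{4,4}&=\sqrt{8+6\sqrt 2}+\sqrt{6+4\sqrt 2},\\ A_{4,7}&=\frac{(3+\sqrt 7)(4+\sqrt{14})}{2},\\ A_{4,8}&=\sqrt{52+36\sqrt 2+(32+24\sqrt2)a}+\sqrt{56+40\sqrt 2+(36+26\sqrt2)a},\\ A_{4,9}&=\sqrt{94+66\sqrt 2+38\sqrt 6+54\sqrt 3}+\sqrt{93+66\sqrt 2+38\sqrt 6+54\sqrt 3},\\ A_{4,12}&=\sqrt{402+232\sqrt3+284\sqrt2+164\sqrt 6}+\sqrt{416+240\sqrt3+294\sqrt2+170\sqrt6},\\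 A_{4,28}&=\sqrt{2(64641+17276\sqrt{14}+24432\sqrt7+45708\sqrt2)}\\ &\quad+2\sqrt{32384+22899\sqrt2+12240\sqrt7+8655\sqrt{14}}. \end{align*} -/

import Mathlib

noncomputable section

/-- Ramanujan's theta function `φ(q) = ∑_{n ∈ ℤ} q^(n²)`, for real `|q| < 1`. -/
def ramanujanPhi (q : ℝ) : ℝ := ∑' n : ℤ, q ^ (n ^ 2)

/-- Ramanujan's theta function `ψ(q) = ∑_{n ≥ 0} q^(n(n+1)/2)`, for real `|q| < 1`.
The natural-number division is exact, since `n(n+1)` is even. -/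
def ramanujanPsi (q : ℝ) : ℝ := ∑' n : ℕ, q ^ (n * (n + 1) / 2)

/-- The nome `q = exp(-π √(n/k))`, for positive real `k` and `n`. -/
def nomeA (k n : ℝ) : ℝ := Real.exp (-Real.pi * √(n / k))

/-- The parameter `A_{k,n} = φ(-q) / (2 k^(1/4) q^(k/4) ψ(q^(2k)))` with `q = exp(-π √(n/k))`,
for positive real `k` and `n`. All powers here are real powers of positive numbers. -/
def paramA (k n : ℝ) : ℝ :=
  ramanujanPhi (-nomeA k n) /
    (2 * k ^ (1 / 4 : ℝ) * nomeA k n ^ (k / 4) * ramanujanPsi (nomeA k n ^ (2 * k)))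

end

/-! Put q = exp(-πt) and u(t) = φ(-q)/φ(q) (`thetaQuot`); classically u(t) = √k' and u(1/t) = √k for
the elliptic modulus k. Since φ(q) - φ(-q) = 4qψ(q^8), A_{4,n} = √2 u/(1 - u) at t = √n/2, so
everything reduces to the values of u.

Four relations determine them: duplication (`thetaQuot_two_mul`), Jacobi's k² + k'² = 1
(`thetaQuot_pow_four_add`), and the modular equations of degrees 3 and 7 (`thetaQuot_cubic`,
`thetaQuot_septic`). The modular equations come from products φ(q)φ(q^c), which are sums over ℤ² of
q^(x² + cy²): multiplication by 1 + √-3, and for c = 7 the form 2a² + ab + b², match congruence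
classes of the lattice at different scales. Poisson summation, t ↦ 1/t, turns φ(q) - φ(-q) into
φ(-q) at the inverted argument.

At t = 1/√c the degree-c equation involves only u(√c) and u(1/√c), so with Jacobi's relation it
becomes a quadratic in u(√c)^4. The degree-3 equation at t = 1 likewise leads to u(3). The bound
u(t) ≥ 4/5 for t ≥ 1 selects the root. -/

/-! ### Theta series and their products as lattice sums. -/

/-- The term `exp (-π t k)` of a theta series. -/
noncomputable def thetaTerm (t : ℝ) (k : ℤ) : ℝ := Real.exp (-Real.pi * t * k)

/-- The sign `(-1)^n`. -/
noncomputable def paritySign (n : ℤ) : ℝ := if Even n then 1 else -1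

/-- `φ(q)` at `q = exp (-π t)`. -/
noncomputable def thetaThree (t : ℝ) : ℝ := ∑' n : ℤ, thetaTerm t (n ^ 2)

/-- `φ(-q)` at `q = exp (-π t)`. -/
noncomputable def thetaFour (t : ℝ) : ℝ := ∑' n : ℤ, paritySign n * thetaTerm t (n ^ 2)

theorem thetaTerm_pos (t : ℝ) (k : ℤ) : 0 < thetaTerm t k := Real.exp_pos _

theorem thetaTerm_add (t : ℝ) (a b : ℤ) : thetaTerm t (a + b) = thetaTerm t a * thetaTerm t b := by
  simp only [thetaTerm, ← Real.exp_add]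
  congr 1; push_cast; ring

theorem thetaTerm_natCast_mul (c : ℕ) (t : ℝ) (k : ℤ) :
    thetaTerm (c * t) k = thetaTerm t (c * k) := by
  simp only [thetaTerm]
  congr 1; push_cast; ring

theorem abs_paritySign (n : ℤ) : |paritySign n| = 1 := by
  unfold paritySign; split_ifs <;> simp

theorem paritySign_mul (m n : ℤ) : paritySign m * paritySign n = paritySign (m + n) := by
  by_cases hm : Even m <;> by_cases hn : Even n <;> simp [paritySign, Int.even_add, hm, hn]

theorem summable_thetaTerm_sq {t : ℝ} (ht : 0 < t) : Summable fun n : ℤ => thetaTerm t (n ^ 2) := by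
  have h := (hasSum_jacobiTheta₂_term 0 (τ := Complex.I * t) (by simpa using ht)).summable.norm
  refine h.congr fun n => ?_
  rw [norm_jacobiTheta₂_term, thetaTerm]
  congr 1
  simp
  ring

theorem Summable.weighted {ι : Type*} {F a : ι → ℝ} (hF : Summable F) (h0 : ∀ i, 0 ≤ F i)
    (C : ℝ) (ha : ∀ i, |a i| ≤ C) : Summable fun i => a i * F i := by
  refine Summable.of_norm_bounded (hF.mul_left C) fun i => ?_
  rw [Real.norm_eq_abs, abs_mul, abs_of_nonneg (h0 i)]
  exact mul_le_mul_of_nonneg_right (ha i) (h0 i)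

theorem summable_paritySign_mul {t : ℝ} (ht : 0 < t) :
    Summable fun n : ℤ => paritySign n * thetaTerm t (n ^ 2) :=
  (summable_thetaTerm_sq ht).weighted (fun _ => (thetaTerm_pos _ _).le) 1
    fun n => (abs_paritySign n).le

theorem thetaTerm_pair (c : ℕ) (t : ℝ) (a b : ℤ) :
    thetaTerm t (a ^ 2) * thetaTerm (c * t) (b ^ 2) = thetaTerm t (a ^ 2 + c * b ^ 2) := by
  rw [thetaTerm_natCast_mul, thetaTerm_add]

theorem summable_pair {t : ℝ} (ht : 0 < t) {c : ℕ} (hc : 0 < c) :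
    Summable fun p : ℤ × ℤ => thetaTerm t (p.1 ^ 2 + c * p.2 ^ 2) := by
  have hc' : (0 : ℝ) < c := by exact_mod_cast hc
  refine ((summable_thetaTerm_sq ht).mul_of_nonneg (summable_thetaTerm_sq (mul_pos hc' ht))
    (fun _ => (thetaTerm_pos _ _).le) (fun _ => (thetaTerm_pos _ _).le)).congr fun p => ?_
  rw [thetaTerm_pair]

theorem summable_pair_weighted {t : ℝ} (ht : 0 < t) {c : ℕ} (hc : 0 < c) (C : ℝ)
    {a : ℤ × ℤ → ℝ} (ha : ∀ p, |a p| ≤ C) :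
    Summable fun p : ℤ × ℤ => a p * thetaTerm t (p.1 ^ 2 + c * p.2 ^ 2) :=
  (summable_pair ht hc).weighted (fun _ => (thetaTerm_pos _ _).le) C ha

/-- A product of two weighted theta series as a sum over the lattice `ℤ × ℤ`. -/
theorem tsum_mul_tsum_pair {t : ℝ} (ht : 0 < t) {c : ℕ} (hc : 0 < c) (C : ℝ)
    {a b : ℤ → ℝ} (ha : ∀ n, |a n| ≤ C) (hb : ∀ n, |b n| ≤ C) :
    (∑' n, a n * thetaTerm t (n ^ 2)) * (∑' n, b n * thetaTerm (c * t) (n ^ 2)) =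
      ∑' p : ℤ × ℤ, a p.1 * b p.2 * thetaTerm t (p.1 ^ 2 + c * p.2 ^ 2) := by
  have hc' : (0 : ℝ) < c := by exact_mod_cast hc
  have h1 := (summable_thetaTerm_sq ht).weighted (fun _ => (thetaTerm_pos _ _).le) C ha
  have h2 := (summable_thetaTerm_sq (mul_pos hc' ht)).weighted
    (fun _ => (thetaTerm_pos _ _).le) C hb
  rw [tsum_mul_tsum_of_summable_norm h1.norm h2.norm]
  refine tsum_congr fun p => ?_
  rw [← thetaTerm_pair]; ring

theorem thetaThree_mul_thetaThree {t : ℝ} (ht : 0 < t) {c : ℕ} (hc : 0 < c) :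
    thetaThree t * thetaThree (c * t) =
      ∑' p : ℤ × ℤ, thetaTerm t (p.1 ^ 2 + c * p.2 ^ 2) := by
  have := tsum_mul_tsum_pair ht hc 1 (a := fun _ => 1) (b := fun _ => 1) (by simp) (by simp)
  simpa [thetaThree] using this

theorem thetaFour_mul_thetaFour {t : ℝ} (ht : 0 < t) {c : ℕ} (hc : 0 < c) :
    thetaFour t * thetaFour (c * t) =
      ∑' p : ℤ × ℤ, paritySign (p.1 + p.2) * thetaTerm t (p.1 ^ 2 + c * p.2 ^ 2) := by
  have := tsum_mul_tsum_pair ht hc 1 (fun n => (abs_paritySign n).le)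
    (fun n => (abs_paritySign n).le)
  simpa [thetaFour, paritySign_mul] using this

theorem abs_one_sub_paritySign_le (n : ℤ) : |1 - paritySign n| ≤ 2 := by
  unfold paritySign; split_ifs <;> norm_num

theorem thetaThree_sub_thetaFour {t : ℝ} (ht : 0 < t) :
    thetaThree t - thetaFour t = ∑' n : ℤ, (1 - paritySign n) * thetaTerm t (n ^ 2) := by
  rw [thetaThree, thetaFour, ← (summable_thetaTerm_sq ht).tsum_sub (summable_paritySign_mul ht)]
  exact tsum_congr fun n => by ring

theorem sub_mul_sub_pair {t : ℝ} (ht : 0 < t) {c : ℕ} (hc : 0 < c) :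
    (thetaThree t - thetaFour t) * (thetaThree (c * t) - thetaFour (c * t)) =
      ∑' p : ℤ × ℤ, (1 - paritySign p.1) * (1 - paritySign p.2) *
        thetaTerm t (p.1 ^ 2 + c * p.2 ^ 2) := by
  have hc' : (0 : ℝ) < c := by exact_mod_cast hc
  rw [thetaThree_sub_thetaFour ht, thetaThree_sub_thetaFour (mul_pos hc' ht),
    tsum_mul_tsum_pair ht hc 2 abs_one_sub_paritySign_le abs_one_sub_paritySign_le]

/-! ### Even part, inversion and size of the theta series. -/

theorem thetaThree_add_thetaFour {t : ℝ} (ht : 0 < t) :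
    thetaThree t + thetaFour t = 2 * thetaThree (4 * t) := by
  rw [thetaThree, thetaFour, ← (summable_thetaTerm_sq ht).tsum_add (summable_paritySign_mul ht),
    thetaThree, ← tsum_mul_left]
  have hinj : Function.Injective fun n : ℤ => 2 * n := fun a b h => by simpa using h
  rw [← hinj.tsum_eq]
  · refine tsum_congr fun n => ?_
    have := thetaTerm_natCast_mul 4 t (n ^ 2)
    push_cast at this
    rw [this, paritySign, if_pos (even_two_mul n), mul_pow]
    norm_num
    ring
  · intro n hn
    by_contra h
    apply hn
    have : ¬ Even n := fun ⟨k, hk⟩ => h ⟨k, by simp only; omega⟩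
    simp [paritySign, this]

theorem thetaThree_inv {t : ℝ} (ht : 0 < t) : thetaThree (1 / t) = √t * thetaThree t := by
  have h := Real.tsum_exp_neg_mul_int_sq ht
  have h0 : √t ≠ 0 := (Real.sqrt_pos.2 ht).ne'
  have e1 : thetaThree t = ∑' n : ℤ, Real.exp (-Real.pi * t * (n : ℝ) ^ 2) :=
    tsum_congr fun n => by simp [thetaTerm]
  have e2 : thetaThree (1 / t) = ∑' n : ℤ, Real.exp (-Real.pi / t * (n : ℝ) ^ 2) :=
    tsum_congr fun n => by simp [thetaTerm, div_eq_mul_inv]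
  rw [e1, e2, h, ← Real.sqrt_eq_rpow]
  field_simp

theorem one_lt_thetaThree {t : ℝ} (ht : 0 < t) : 1 < thetaThree t := by
  have h := (summable_thetaTerm_sq ht).sum_le_tsum {0, 1} fun _ _ => (thetaTerm_pos _ _).le
  have h1 := thetaTerm_pos t 1
  rw [Finset.sum_pair (by norm_num)] at h
  have h0 : thetaTerm t (0 ^ 2) = 1 := by simp [thetaTerm]
  rw [h0, one_pow] at h
  exact lt_of_lt_of_le (by linarith) h

theorem thetaThree_lt_of_lt {s t : ℝ} (hs : 0 < s) (hst : s < t) : thetaThree t < thetaThree s := by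
  refine Summable.tsum_lt_tsum (i := 1) (fun n => ?_) ?_
    (summable_thetaTerm_sq (hs.trans hst)) (summable_thetaTerm_sq hs)
  · refine Real.exp_le_exp.2 ?_
    have : (0 : ℝ) ≤ ((n ^ 2 : ℤ) : ℝ) := by exact_mod_cast sq_nonneg n
    have := mul_le_mul_of_nonneg_right (mul_le_mul_of_nonneg_left hst.le Real.pi_pos.le) this
    linarith
  · refine Real.exp_lt_exp.2 ?_
    have := mul_lt_mul_of_pos_left hst Real.pi_pos
    norm_num
    linarith

/-- The constant 10/9 is what `four_fifths_le_thetaQuot` needs: 2 - 10/9 = (4/5)(10/9). -/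
theorem thetaThree_le {t : ℝ} (ht : 1 ≤ t) : thetaThree t ≤ 10 / 9 := by
  have h0 : 0 < t := by linarith
  have h := norm_jacobiTheta_sub_one_le (τ := Complex.I * t) (by simpa using h0)
  have e : jacobiTheta (Complex.I * t) = (thetaThree t : ℝ) := by
    rw [jacobiTheta, thetaThree, Complex.ofReal_tsum]
    refine tsum_congr fun n => ?_
    rw [thetaTerm, Complex.ofReal_exp]
    congr 1
    push_cast
    linear_combination (Real.pi * n ^ 2 * t : ℂ) * Complex.I_sq
  rw [e, ← Complex.ofReal_one, ← Complex.ofReal_sub, Complex.norm_real] at h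
  have h1 := (Real.le_norm_self _).trans h
  have him : (Complex.I * (t : ℂ)).im = t := by simp
  rw [him] at h1
  -- At q = 1/19 the tail bound 2q/(1 - q) is exactly 1/9; the estimate holds because π > 3 and 2.7³
  -- > 19.
  have hq : Real.exp (-Real.pi * t) ≤ 1 / 19 := by
    have h3 : Real.exp (-Real.pi * t) ≤ Real.exp (-3) := by
      apply Real.exp_le_exp.2
      nlinarith [Real.pi_gt_three]
    have h4 : Real.exp (-3) * Real.exp 3 = 1 := by rw [← Real.exp_add]; simp
    have h5 : (19 : ℝ) ≤ Real.exp 3 := by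
      have h6 : Real.exp 3 = Real.exp 1 ^ 3 := by rw [← Real.exp_nat_mul]; norm_num
      rw [h6]
      have := Real.exp_one_gt_d9
      calc (19 : ℝ) ≤ 2.7 ^ 3 := by norm_num
        _ ≤ _ := by gcongr; linarith
    nlinarith [Real.exp_pos (-3)]
  set q := Real.exp (-Real.pi * t)
  have : 2 / (1 - q) * q ≤ 1 / 9 := by
    rw [div_mul_eq_mul_div, div_le_iff₀ (by linarith)]
    linarith
  linarith

/-! ### From ψ and A_{4,n} to the theta series. -/

theorem tsum_int_of_reflect {F : ℤ → ℝ} (hF : Summable F)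
    (h : ∀ n : ℕ, F (-((n : ℤ) + 1)) = F n) : ∑' n, F n = 2 * ∑' n : ℕ, F n := by
  have hN : Summable fun n : ℕ => F n := hF.comp_injective Nat.cast_injective
  rw [tsum_of_nat_of_neg_add_one hN (hN.congr fun n => (h n).symm), tsum_congr h, two_mul]

/-- Only odd exponents survive, and (2n + 1)² = 1 + 8·n(n + 1)/2; the reflection n ↦ -n - 1 supplies
another factor 2. -/
theorem thetaThree_sub_thetaFour_eq_psi {t : ℝ} (ht : 0 < t) :
    thetaThree t - thetaFour t =
      4 * Real.exp (-Real.pi * t) * ramanujanPsi (Real.exp (-Real.pi * t) ^ 8) := by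
  have hinj : Function.Injective fun n : ℤ => 2 * n + 1 := fun a b h => by simpa using h
  have hodd (n : ℤ) : paritySign (2 * n + 1) = -1 := by simp [paritySign]
  rw [thetaThree_sub_thetaFour ht, ← hinj.tsum_eq]
  · have hs : Summable fun n : ℤ => (1 - paritySign (2 * n + 1)) *
        thetaTerm t ((2 * n + 1) ^ 2) :=
      ((summable_thetaTerm_sq ht).weighted (fun _ => (thetaTerm_pos _ _).le) 2
        abs_one_sub_paritySign_le).comp_injective hinj
    have key (n : ℕ) : thetaTerm t ((2 * n + 1) ^ 2) =
        Real.exp (-Real.pi * t) * (Real.exp (-Real.pi * t) ^ 8) ^ (n * (n + 1) / 2) := by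
      rw [← pow_mul, ← Real.exp_nat_mul, ← Real.exp_add, thetaTerm]
      congr 1
      have h2 : 2 * (n * (n + 1) / 2) = n * (n + 1) :=
        Nat.mul_div_cancel' (Nat.even_mul_succ_self n).two_dvd
      have h3 : (2 : ℝ) * ((n * (n + 1) / 2 : ℕ) : ℝ) = n * (n + 1) := by exact_mod_cast h2
      push_cast at h3 ⊢
      linear_combination (4 * Real.pi * t) * h3
    rw [tsum_int_of_reflect hs fun n => ?_, ramanujanPsi, ← tsum_mul_left, ← tsum_mul_left]
    · refine tsum_congr fun n => ?_
      rw [hodd, key]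
      ring
    · rw [hodd, hodd, show (2 * -((n : ℤ) + 1) + 1) ^ 2 = (2 * (n : ℤ) + 1) ^ 2 by ring]
  · intro n hn
    by_contra h
    apply hn
    have : Even n := by
      by_contra h'
      obtain ⟨k, hk⟩ := Int.not_even_iff_odd.1 h'
      exact h ⟨k, hk.symm⟩
    simp [paritySign, this]

theorem ramanujanPhi_eq (t : ℝ) : ramanujanPhi (-Real.exp (-Real.pi * t)) = thetaFour t := by
  refine tsum_congr fun n => ?_
  rw [paritySign, thetaTerm]
  have e : Real.exp (-Real.pi * t * ((n ^ 2 : ℤ) : ℝ)) = Real.exp (-Real.pi * t) ^ (n ^ 2) := by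
    rw [← Real.rpow_intCast, ← Real.exp_mul]
  rw [e]
  split_ifs with h
  · rw [one_mul, Even.neg_zpow (h.pow_of_ne_zero two_ne_zero)]
  · rw [Odd.neg_zpow ((Int.not_even_iff_odd.1 h).pow), neg_one_mul]

theorem paramA_four (n : ℝ) (hn : 0 < n) :
    paramA 4 n = √2 * thetaFour (√(n / 4)) /
      (thetaThree (√(n / 4)) - thetaFour (√(n / 4))) := by
  have ht : 0 < √(n / 4) := Real.sqrt_pos.2 (by positivity)
  have h2 : (4 : ℝ) ^ (1 / 4 : ℝ) = √2 := by
    rw [Real.sqrt_eq_rpow, show (4 : ℝ) = 2 ^ (2 : ℝ) by norm_num, ← Real.rpow_mul (by norm_num)]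
    norm_num
  have h8 : nomeA 4 n ^ (2 * 4 : ℝ) = nomeA 4 n ^ 8 := by
    rw [← Real.rpow_natCast]; norm_num
  have h1 : nomeA 4 n ^ (4 / 4 : ℝ) = nomeA 4 n := by
    rw [div_self (by norm_num), Real.rpow_one]
  rw [paramA, h2, h8, h1, thetaThree_sub_thetaFour_eq_psi ht, nomeA, ramanujanPhi_eq]
  have hs : √2 * √2 = 2 := Real.mul_self_sqrt (by norm_num)
  have hs0 : √2 ≠ 0 := by positivity
  rw [show 4 * Real.exp (-Real.pi * √(n / 4)) * ramanujanPsi (Real.exp (-Real.pi * √(n / 4)) ^ 8) =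
    √2 * (2 * √2 * Real.exp (-Real.pi * √(n / 4)) *
      ramanujanPsi (Real.exp (-Real.pi * √(n / 4)) ^ 8)) by
      linear_combination (-2 * Real.exp (-Real.pi * √(n / 4)) *
        ramanujanPsi (Real.exp (-Real.pi * √(n / 4)) ^ 8)) * hs, mul_div_mul_left _ _ hs0]

/-! ### Lattice reindexing and the degree 2 identities. -/

theorem tsum_neg_snd (F : ℤ × ℤ → ℝ) : ∑' p : ℤ × ℤ, F (p.1, -p.2) = ∑' p, F p :=
  ((Equiv.refl ℤ).prodCongr (Equiv.neg ℤ)).tsum_eq F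

theorem tsum_swap (F : ℤ × ℤ → ℝ) : ∑' p : ℤ × ℤ, F (p.2, p.1) = ∑' p, F p :=
  (Equiv.prodComm ℤ ℤ).tsum_eq F

/-- The map need not be onto: it only has to cover the support of `F`, which in each use is cut out
by a congruence condition. -/
theorem tsum_linear_change {F G : ℤ × ℤ → ℝ} (i : ℤ × ℤ → ℤ × ℤ) (hi : Function.Injective i)
    (hF : ∀ p, F p ≠ 0 → ∃ x, i x = p) (h : ∀ p, F (i p) = G p) : ∑' p, F p = ∑' p, G p := by
  rw [← hi.tsum_eq (fun p hp => hF p hp)]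
  exact tsum_congr h

/-- The signs keep the pairs with even sum, and these are the points (a + b, a - b), where the form
x² + y² doubles. -/
theorem thetaThree_sq_add_thetaFour_sq {t : ℝ} (ht : 0 < t) :
    thetaThree t ^ 2 + thetaFour t ^ 2 = 2 * thetaThree (2 * t) ^ 2 := by
  have h3 := thetaThree_mul_thetaThree ht one_pos
  have h4 := thetaFour_mul_thetaFour ht one_pos
  have h2 := thetaThree_mul_thetaThree (mul_pos two_pos ht) one_pos
  simp only [Nat.cast_one, one_mul] at h3 h4 h2
  have s3 := summable_pair ht one_pos
  have s4 := summable_pair_weighted ht one_pos 1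
    (a := fun p => paritySign (p.1 + p.2)) fun p => (abs_paritySign _).le
  simp only [Nat.cast_one, one_mul] at s3 s4
  rw [sq, sq, sq, h3, h4, h2, ← s3.tsum_add s4, ← tsum_mul_left]
  refine tsum_linear_change (fun p => (p.1 + p.2, p.1 - p.2)) ?_ ?_ ?_
  · rintro ⟨a, b⟩ ⟨c, d⟩ h
    simp only [Prod.mk.injEq] at h ⊢
    omega
  · rintro ⟨a, b⟩ h
    have : Even (a + b) := by
      by_contra h'
      simp [paritySign, h'] at h
    obtain ⟨k, hk⟩ := this
    exact ⟨(k, a - k), by simp only [Prod.mk.injEq]; omega⟩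
  · rintro ⟨a, b⟩
    have e := thetaTerm_natCast_mul 2 t (a ^ 2 + b ^ 2)
    push_cast at e
    have : Even (a + b + (a - b)) := ⟨a, by ring⟩
    simp only [paritySign, this, if_true, e]
    rw [show (a + b) ^ 2 + (a - b) ^ 2 = 2 * (a ^ 2 + b ^ 2) by ring]
    ring

/-- Symmetrising the sign under the swap of coordinates cancels pairs of mixed parity; the rest are
again the points (a + b, a - b). -/
theorem thetaThree_mul_thetaFour {t : ℝ} (ht : 0 < t) :
    thetaThree t * thetaFour t = thetaFour (2 * t) ^ 2 := by
  have h1 := tsum_mul_tsum_pair ht one_pos 1 (a := fun _ => 1) (b := paritySign) (by simp)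
    (fun n => (abs_paritySign n).le)
  have h4 := thetaFour_mul_thetaFour (mul_pos two_pos ht) one_pos
  simp only [Nat.cast_one, one_mul] at h1 h4
  have s1 := summable_pair_weighted ht one_pos 1
    (a := fun p => paritySign p.1) fun p => (abs_paritySign _).le
  have s2 := summable_pair_weighted ht one_pos 1
    (a := fun p => paritySign p.2) fun p => (abs_paritySign _).le
  simp only [Nat.cast_one, one_mul] at s1 s2
  have hsw : ∑' p : ℤ × ℤ, paritySign p.2 * thetaTerm t (p.1 ^ 2 + p.2 ^ 2) =
      ∑' p : ℤ × ℤ, paritySign p.1 * thetaTerm t (p.1 ^ 2 + p.2 ^ 2) := by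
    rw [← tsum_swap]
    exact tsum_congr fun p => by rw [add_comm (p.2 ^ 2)]
  have key : ∑' p : ℤ × ℤ, (paritySign p.1 * thetaTerm t (p.1 ^ 2 + p.2 ^ 2) +
      paritySign p.2 * thetaTerm t (p.1 ^ 2 + p.2 ^ 2)) =
      ∑' p : ℤ × ℤ, 2 * (paritySign (p.1 + p.2) * thetaTerm (2 * t) (p.1 ^ 2 + p.2 ^ 2)) := by
    refine tsum_linear_change (fun p => (p.1 + p.2, p.1 - p.2)) ?_ ?_ ?_
    · rintro ⟨a, b⟩ ⟨c, d⟩ h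
      simp only [Prod.mk.injEq] at h ⊢
      omega
    · rintro ⟨a, b⟩ h
      have : Even (a + b) := by
        by_contra h'
        rw [← add_mul] at h
        simp only [Int.even_add] at h'
        unfold paritySign at h
        split_ifs at h <;> simp_all
      obtain ⟨k, hk⟩ := this
      exact ⟨(k, a - k), by simp only [Prod.mk.injEq]; omega⟩
    · rintro ⟨a, b⟩
      have e := thetaTerm_natCast_mul 2 t (a ^ 2 + b ^ 2)
      push_cast at e
      have : paritySign (a - b) = paritySign (a + b) := by
        simp only [paritySign, Int.even_add, Int.even_sub]
      simp only [this, e]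
      rw [show (a + b) ^ 2 + (a - b) ^ 2 = 2 * (a ^ 2 + b ^ 2) by ring]
      ring
  rw [s1.tsum_add s2, tsum_mul_left, ← h4] at key
  have h1' : thetaThree t * thetaFour t =
      ∑' p : ℤ × ℤ, paritySign p.2 * thetaTerm t (p.1 ^ 2 + p.2 ^ 2) := h1
  linarith [sq (thetaFour (2 * t))]

/-! ### Theta identities of degrees 3 and 7. -/

/-- The indicator of the pairs `(a, b)` with `b` odd and `a ≡ b` modulo `4`. -/
def oddDiag (p : ℤ × ℤ) : ℝ := if p.2 % 2 = 1 ∧ (p.1 - p.2) % 4 = 0 then 1 else 0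

theorem paritySign_eq (n : ℤ) : paritySign n = if n % 2 = 0 then 1 else -1 := by
  simp only [paritySign, Int.even_iff]

/-- Odd a and b satisfy exactly one of a ≡ b, a ≡ -b modulo 4. The form is invariant under b ↦ -b,
so one class carries half of the sum over odd pairs. -/
theorem one_sub_mul_one_sub (a b : ℤ) :
    (1 - paritySign a) * (1 - paritySign b) = 4 * (oddDiag (a, b) + oddDiag (a, -b)) := by
  simp only [paritySign_eq, oddDiag]
  split_ifs <;> first | (exfalso; omega) | norm_num

theorem abs_oddDiag_le (p : ℤ × ℤ) : |oddDiag p| ≤ 1 := by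
  unfold oddDiag; split_ifs <;> simp

theorem sub_mul_sub_eq_oddDiag {t : ℝ} (ht : 0 < t) {c : ℕ} (hc : 0 < c) :
    (thetaThree t - thetaFour t) * (thetaThree (c * t) - thetaFour (c * t)) =
      8 * ∑' p : ℤ × ℤ, oddDiag p * thetaTerm t (p.1 ^ 2 + c * p.2 ^ 2) := by
  have s1 := summable_pair_weighted ht hc 1 abs_oddDiag_le
  have s2 := summable_pair_weighted ht hc 1
    (a := fun p => oddDiag (p.1, -p.2)) fun p => abs_oddDiag_le _
  have hn := tsum_neg_snd fun p => oddDiag p * thetaTerm t (p.1 ^ 2 + c * p.2 ^ 2)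
  simp only [neg_sq] at hn
  rw [sub_mul_sub_pair ht hc]
  calc _ = ∑' p : ℤ × ℤ, 4 * (oddDiag p * thetaTerm t (p.1 ^ 2 + c * p.2 ^ 2) +
        oddDiag (p.1, -p.2) * thetaTerm t (p.1 ^ 2 + c * p.2 ^ 2)) :=
        tsum_congr fun p => by rw [one_sub_mul_one_sub]; ring
    _ = _ := by rw [tsum_mul_left, s1.tsum_add s2, hn]; ring

/-- Multiplication of a + b√-3 by 1 + √-3, of norm 4, carries the pairs with a + b odd onto the
class x ≡ y modulo 4 with y odd. -/
theorem theta_cubic {s : ℝ} (hs : 0 < s) :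
    thetaThree (4 * s) * thetaThree (3 * (4 * s)) - thetaFour (4 * s) * thetaFour (3 * (4 * s)) =
      (thetaThree s - thetaFour s) * (thetaThree (3 * s) - thetaFour (3 * s)) / 4 := by
  have hs4 : 0 < 4 * s := by linarith
  have h3 := thetaThree_mul_thetaThree hs4 (c := 3) (by norm_num)
  have h4 := thetaFour_mul_thetaFour hs4 (c := 3) (by norm_num)
  have s3 := summable_pair hs4 (c := 3) (by norm_num)
  have s4 := summable_pair_weighted hs4 (c := 3) (by norm_num) 1
    (a := fun p => paritySign (p.1 + p.2)) fun p => (abs_paritySign _).le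
  have hd := sub_mul_sub_eq_oddDiag hs (c := 3) (by norm_num)
  push_cast at h3 h4 s3 s4 hd
  have key : ∑' p : ℤ × ℤ, oddDiag p * thetaTerm s (p.1 ^ 2 + 3 * p.2 ^ 2) =
      ∑' p : ℤ × ℤ, (1 / 2 : ℝ) * (thetaTerm (4 * s) (p.1 ^ 2 + 3 * p.2 ^ 2) -
        paritySign (p.1 + p.2) * thetaTerm (4 * s) (p.1 ^ 2 + 3 * p.2 ^ 2)) := by
    refine tsum_linear_change (fun p => (p.1 - 3 * p.2, p.1 + p.2)) ?_ ?_ ?_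
    · rintro ⟨a, b⟩ ⟨c, d⟩ h
      simp only [Prod.mk.injEq] at h ⊢
      omega
    · rintro ⟨a, b⟩ h
      have : (a - b) % 4 = 0 := by
        by_contra h'
        simp [oddDiag, h'] at h
      exact ⟨(b - (b - a) / 4, (b - a) / 4), by simp only [Prod.mk.injEq]; omega⟩
    · rintro ⟨a, b⟩
      have e := thetaTerm_natCast_mul 4 s (a ^ 2 + 3 * b ^ 2)
      push_cast at e
      simp only [e]
      rw [show (a - 3 * b) ^ 2 + 3 * (a + b) ^ 2 = 4 * (a ^ 2 + 3 * b ^ 2) by ring]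
      have : oddDiag (a - 3 * b, a + b) = 1 / 2 * (1 - paritySign (a + b)) := by
        simp only [oddDiag, paritySign_eq]
        split_ifs <;> first | (exfalso; omega) | norm_num
      rw [this]; ring
  rw [hd, h3, h4, key, tsum_mul_left, s3.tsum_sub s4]
  ring

/-- The indicator of `x + y ≡ r` modulo `4`. -/
def sumMod (r : ℤ) (p : ℤ × ℤ) : ℝ := if (p.1 + p.2) % 4 = r then 1 else 0

theorem abs_sumMod_le (r : ℤ) (p : ℤ × ℤ) : |sumMod r p| ≤ 1 := by
  unfold sumMod; split_ifs <;> simp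

/-- Both sides are the sum over a + b odd of the terms with exponent 8(2a² + ab + b²) at `s`, since
(b - 3a)² + 7(a + b)² = 2((a + 2b)² + 7a²). -/
theorem tsum_oddDiag_seven (s : ℝ) :
    ∑' p : ℤ × ℤ, oddDiag p * thetaTerm s (p.1 ^ 2 + 7 * p.2 ^ 2) =
      ∑' p : ℤ × ℤ, sumMod 2 p * thetaTerm (2 * s) (p.1 ^ 2 + 7 * p.2 ^ 2) := by
  have h1 : ∑' p : ℤ × ℤ, oddDiag p * thetaTerm s (p.1 ^ 2 + 7 * p.2 ^ 2) =
      ∑' p : ℤ × ℤ, (1 - paritySign (p.1 + p.2)) / 2 *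
        thetaTerm s ((p.2 - 3 * p.1) ^ 2 + 7 * (p.1 + p.2) ^ 2) := by
    refine tsum_linear_change (fun p => (p.2 - 3 * p.1, p.1 + p.2)) ?_ ?_ ?_
    · rintro ⟨a, b⟩ ⟨c, d⟩ h
      simp only [Prod.mk.injEq] at h ⊢
      omega
    · rintro ⟨a, b⟩ h
      have : (a - b) % 4 = 0 := by
        by_contra h'
        simp [oddDiag, h'] at h
      exact ⟨((b - a) / 4, b - (b - a) / 4), by simp only [Prod.mk.injEq]; omega⟩
    · rintro ⟨a, b⟩
      simp only
      congr 1
      simp only [oddDiag, paritySign_eq]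
      split_ifs <;> first | (exfalso; omega) | norm_num
  rw [h1]
  symm
  refine tsum_linear_change (fun p => (p.1 + 2 * p.2, p.1)) ?_ ?_ ?_
  · rintro ⟨a, b⟩ ⟨c, d⟩ h
    simp only [Prod.mk.injEq] at h ⊢
    omega
  · rintro ⟨a, b⟩ h
    have : (a + b) % 4 = 2 := by
      by_contra h'
      simp [sumMod, h'] at h
    exact ⟨(b, (a - b) / 2), by simp only [Prod.mk.injEq, and_true]; omega⟩
  · rintro ⟨a, b⟩
    have e := thetaTerm_natCast_mul 2 s ((a + 2 * b) ^ 2 + 7 * a ^ 2)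
    push_cast at e
    simp only [e]
    congr 1
    · simp only [sumMod, paritySign_eq]
      split_ifs <;> first | (exfalso; omega) | norm_num
    · congr 1; ring

/-- The same two substitutions, now with no restriction on (a, b). -/
theorem tsum_even_seven (s : ℝ) :
    ∑' p : ℤ × ℤ, (1 + paritySign (p.1 + p.2)) / 2 *
        thetaTerm (2 * s) (p.1 ^ 2 + 7 * p.2 ^ 2) =
      ∑' p : ℤ × ℤ, sumMod 0 p * thetaTerm s (p.1 ^ 2 + 7 * p.2 ^ 2) := by
  have h1 : ∑' p : ℤ × ℤ, sumMod 0 p * thetaTerm s (p.1 ^ 2 + 7 * p.2 ^ 2) =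
      ∑' p : ℤ × ℤ, thetaTerm s ((p.2 - 3 * p.1) ^ 2 + 7 * (p.1 + p.2) ^ 2) := by
    refine tsum_linear_change (fun p => (p.2 - 3 * p.1, -(p.1 + p.2))) ?_ ?_ ?_
    · rintro ⟨a, b⟩ ⟨c, d⟩ h
      simp only [Prod.mk.injEq] at h ⊢
      omega
    · rintro ⟨a, b⟩ h
      have : (a + b) % 4 = 0 := by
        by_contra h'
        simp [sumMod, h'] at h
      exact ⟨(-(a + b) / 4, -b + (a + b) / 4), by simp only [Prod.mk.injEq]; omega⟩
    · rintro ⟨a, b⟩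
      have : (b - 3 * a + -(a + b)) % 4 = 0 := by omega
      simp only [sumMod, this, if_true, one_mul, neg_sq]
  rw [h1]
  refine tsum_linear_change (fun p => (p.1 + 2 * p.2, p.1)) ?_ ?_ ?_
  · rintro ⟨a, b⟩ ⟨c, d⟩ h
    simp only [Prod.mk.injEq] at h ⊢
    omega
  · rintro ⟨a, b⟩ h
    have : (a + b) % 2 = 0 := by
      by_contra h'
      simp [paritySign_eq, h'] at h
    exact ⟨(b, (a - b) / 2), by simp only [Prod.mk.injEq, and_true]; omega⟩
  · rintro ⟨a, b⟩
    have e := thetaTerm_natCast_mul 2 s ((a + 2 * b) ^ 2 + 7 * a ^ 2)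
    push_cast at e
    have : (a + 2 * b + a) % 2 = 0 := by omega
    simp only [e, paritySign_eq, this, if_true]
    norm_num
    congr 1; ring

/-- For x, y both odd, x + y and x - y differ by 2 modulo 4, so averaging over y ↦ -y cancels these
pairs. Only pairs of even coordinates remain, and halving them multiplies `s` by 4. -/
theorem tsum_sumMod_sub {s : ℝ} (hs : 0 < s) :
    ∑' p : ℤ × ℤ, (sumMod 0 p - sumMod 2 p) * thetaTerm s (p.1 ^ 2 + 7 * p.2 ^ 2) =
      ∑' p : ℤ × ℤ, paritySign (p.1 + p.2) * thetaTerm (4 * s) (p.1 ^ 2 + 7 * p.2 ^ 2) := by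
  have hb (p : ℤ × ℤ) : |sumMod 0 p - sumMod 2 p| ≤ 2 := by
    refine (abs_sub _ _).trans ?_
    linarith [abs_sumMod_le 0 p, abs_sumMod_le 2 p]
  have s1 := summable_pair_weighted hs (c := 7) (by norm_num) 2 hb
  have s2 := summable_pair_weighted hs (c := 7) (by norm_num) 2
    (a := fun p => sumMod 0 (p.1, -p.2) - sumMod 2 (p.1, -p.2)) fun p => hb _
  have hn := tsum_neg_snd fun p =>
    (sumMod 0 p - sumMod 2 p) * thetaTerm s (p.1 ^ 2 + 7 * p.2 ^ 2)
  simp only [neg_sq] at hn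
  push_cast at s1 s2
  have key : ∑' p : ℤ × ℤ, ((sumMod 0 p - sumMod 2 p) * thetaTerm s (p.1 ^ 2 + 7 * p.2 ^ 2) +
      (sumMod 0 (p.1, -p.2) - sumMod 2 (p.1, -p.2)) * thetaTerm s (p.1 ^ 2 + 7 * p.2 ^ 2)) =
      ∑' p : ℤ × ℤ, 2 * (paritySign (p.1 + p.2) *
        thetaTerm (4 * s) (p.1 ^ 2 + 7 * p.2 ^ 2)) := by
    refine tsum_linear_change (fun p => (2 * p.1, 2 * p.2)) ?_ ?_ ?_
    · rintro ⟨a, b⟩ ⟨c, d⟩ h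
      simp only [Prod.mk.injEq] at h ⊢
      omega
    · rintro ⟨a, b⟩ h
      have : a % 2 = 0 ∧ b % 2 = 0 := by
        by_contra h'
        rw [← add_mul] at h
        apply left_ne_zero_of_mul h
        simp only [sumMod]
        split_ifs <;> first | (exfalso; omega) | norm_num
      exact ⟨(a / 2, b / 2), by simp only [Prod.mk.injEq]; omega⟩
    · rintro ⟨a, b⟩
      have e := thetaTerm_natCast_mul 4 s (a ^ 2 + 7 * b ^ 2)
      push_cast at e
      simp only [e]
      rw [show (2 * a) ^ 2 + 7 * (2 * b) ^ 2 = 4 * (a ^ 2 + 7 * b ^ 2) by ring, ← add_mul,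
        ← mul_assoc]
      congr 1
      simp only [sumMod, paritySign_eq]
      split_ifs <;> first | (exfalso; omega) | norm_num
  rw [s1.tsum_add s2, hn, tsum_mul_left] at key
  linarith

/-- The left side is twice the difference of the classes 0 and 2 of x + y modulo 4 at scale 2s,
which `tsum_sumMod_sub` evaluates. -/
theorem theta_septic {s : ℝ} (hs : 0 < s) :
    thetaThree (4 * s) * thetaThree (7 * (4 * s)) + thetaFour (4 * s) * thetaFour (7 * (4 * s)) -
      (thetaThree s - thetaFour s) * (thetaThree (7 * s) - thetaFour (7 * s)) / 4 =
      2 * (thetaFour (8 * s) * thetaFour (7 * (8 * s))) := by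
  have hs4 : 0 < 4 * s := by linarith
  have hs2 : 0 < 2 * s := by linarith
  have hs8 : 0 < 8 * s := by linarith
  have h3 := thetaThree_mul_thetaThree hs4 (c := 7) (by norm_num)
  have h4 := thetaFour_mul_thetaFour hs4 (c := 7) (by norm_num)
  have h8 := thetaFour_mul_thetaFour hs8 (c := 7) (by norm_num)
  have s3 := summable_pair hs4 (c := 7) (by norm_num)
  have s4 := summable_pair_weighted hs4 (c := 7) (by norm_num) 1
    (a := fun p => paritySign (p.1 + p.2)) fun p => (abs_paritySign _).le
  have r0 := summable_pair_weighted hs2 (c := 7) (by norm_num) 1 (abs_sumMod_le 0)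
  have r2 := summable_pair_weighted hs2 (c := 7) (by norm_num) 1 (abs_sumMod_le 2)
  have hd := sub_mul_sub_eq_oddDiag hs (c := 7) (by norm_num)
  have he := tsum_even_seven (2 * s)
  have hm := tsum_sumMod_sub hs2
  push_cast at h3 h4 h8 s3 s4 hd r0 r2
  rw [show 2 * (2 * s) = 4 * s by ring] at he
  rw [show 4 * (2 * s) = 8 * s by ring, ← h8] at hm
  simp only [sub_mul] at hm
  rw [r0.tsum_sub r2] at hm
  have he' : ∑' p : ℤ × ℤ, (1 + paritySign (p.1 + p.2)) / 2 *
      thetaTerm (4 * s) (p.1 ^ 2 + 7 * p.2 ^ 2) = (∑' p : ℤ × ℤ,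
        thetaTerm (4 * s) (p.1 ^ 2 + 7 * p.2 ^ 2) + ∑' p : ℤ × ℤ,
        paritySign (p.1 + p.2) * thetaTerm (4 * s) (p.1 ^ 2 + 7 * p.2 ^ 2)) / 2 := by
    rw [← s3.tsum_add s4, ← tsum_div_const]
    exact tsum_congr fun p => by ring
  rw [hd, tsum_oddDiag_seven]
  linarith

/-! ### The theta quotient and its modular equations. -/

/-- The quotient `φ(-q) / φ(q)` at `q = exp (-π t)`. -/
noncomputable def thetaQuot (t : ℝ) : ℝ := thetaFour t / thetaThree t

theorem thetaThree_pos {t : ℝ} (ht : 0 < t) : 0 < thetaThree t :=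
  zero_lt_one.trans (one_lt_thetaThree ht)

theorem thetaThree_inv_four {s : ℝ} (hs : 0 < s) :
    thetaThree (1 / (4 * s)) = √s * (thetaThree s + thetaFour s) := by
  rw [thetaThree_inv (by linarith), thetaThree_add_thetaFour hs, Real.sqrt_mul (by norm_num),
    show (4 : ℝ) = 2 ^ 2 by norm_num, Real.sqrt_sq (by norm_num)]
  ring

theorem thetaFour_inv_four {s : ℝ} (hs : 0 < s) :
    thetaFour (1 / (4 * s)) = √s * (thetaThree s - thetaFour s) := by
  have h1 := thetaThree_add_thetaFour (t := 1 / (4 * s)) (by positivity)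
  have h2 := thetaThree_inv hs
  rw [thetaThree_inv_four hs, show 4 * (1 / (4 * s)) = 1 / s by field_simp, h2] at h1
  linarith

theorem thetaFour_lt_thetaThree {t : ℝ} (ht : 0 < t) : thetaFour t < thetaThree t := by
  have h1 := thetaThree_add_thetaFour ht
  have h2 := thetaThree_lt_of_lt ht (show t < 4 * t by linarith)
  linarith

/-- Inversion turns the alternating series into a positive difference θ₃ - θ₄. -/
theorem thetaFour_pos {t : ℝ} (ht : 0 < t) : 0 < thetaFour t := by
  have hs : 0 < 1 / (4 * t) := by positivity
  have h := thetaFour_inv_four hs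
  rw [show 1 / (4 * (1 / (4 * t))) = t by field_simp] at h
  rw [h]
  exact mul_pos (Real.sqrt_pos.2 hs) (sub_pos.2 (thetaFour_lt_thetaThree hs))

theorem thetaQuot_pos {t : ℝ} (ht : 0 < t) : 0 < thetaQuot t :=
  div_pos (thetaFour_pos ht) (thetaThree_pos ht)

theorem thetaQuot_lt_one {t : ℝ} (ht : 0 < t) : thetaQuot t < 1 :=
  (div_lt_one (thetaThree_pos ht)).2 (thetaFour_lt_thetaThree ht)

theorem thetaFour_eq {t : ℝ} (ht : 0 < t) : thetaFour t = thetaQuot t * thetaThree t :=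
  (div_mul_cancel₀ _ (thetaThree_pos ht).ne').symm

theorem four_fifths_le_thetaQuot {t : ℝ} (ht : 1 ≤ t) : 4 / 5 ≤ thetaQuot t := by
  have h0 : 0 < t := by linarith
  rw [thetaQuot, le_div_iff₀ (thetaThree_pos h0)]
  linarith [thetaThree_add_thetaFour h0, thetaThree_le ht,
    one_lt_thetaThree (show 0 < 4 * t by linarith)]

theorem thetaQuot_two_mul {t : ℝ} (ht : 0 < t) :
    thetaQuot (2 * t) ^ 2 * (1 + thetaQuot t ^ 2) = 2 * thetaQuot t := by
  have h1 := thetaThree_sq_add_thetaFour_sq ht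
  have h2 := thetaThree_mul_thetaFour ht
  have ht2 : 0 < 2 * t := by linarith
  rw [thetaFour_eq ht] at h1 h2
  rw [thetaFour_eq ht2] at h2
  have hf := (thetaThree_pos ht).ne'
  apply mul_right_cancel₀ (pow_ne_zero 2 hf)
  linear_combination thetaQuot (2 * t) ^ 2 * h1 - 2 * h2

theorem thetaQuot_inv_four {s : ℝ} (hs : 0 < s) :
    thetaQuot (1 / (4 * s)) * (1 + thetaQuot s) = 1 - thetaQuot s := by
  have hf := (thetaThree_pos hs).ne'
  have hg := (thetaQuot_pos hs)
  rw [thetaQuot, thetaFour_inv_four hs, thetaThree_inv_four hs, thetaFour_eq hs]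
  have h0 : √s ≠ 0 := (Real.sqrt_pos.2 hs).ne'
  have h1 : 1 + thetaQuot s ≠ 0 := by positivity
  rw [show √s * (thetaThree s - thetaQuot s * thetaThree s) =
    (√s * thetaThree s) * (1 - thetaQuot s) by ring,
    show √s * (thetaThree s + thetaQuot s * thetaThree s) =
    (√s * thetaThree s) * (1 + thetaQuot s) by ring]
  field_simp

/-- With t = 4s and u the quotient at s, two duplications give 8u(1 + u²)/(1 + u)^4 and inversion
gives ((1 - u)/(1 + u))^4; the identity is (1 + u)^4 - (1 - u)^4 = 8u(1 + u²). -/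
theorem thetaQuot_pow_four_add {t : ℝ} (ht : 0 < t) :
    thetaQuot t ^ 4 + thetaQuot (1 / t) ^ 4 = 1 := by
  obtain ⟨s, hs, rfl⟩ : ∃ s, 0 < s ∧ t = 4 * s := ⟨t / 4, by positivity, by ring⟩
  have h1 := thetaQuot_two_mul hs
  have h2 := thetaQuot_two_mul (show 0 < 2 * s by linarith)
  have h3 := thetaQuot_inv_four hs
  rw [show 2 * (2 * s) = 4 * s by ring] at h2
  have hu := thetaQuot_pos hs
  have e1 : thetaQuot (2 * s) ^ 2 = 2 * thetaQuot s / (1 + thetaQuot s ^ 2) := by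
    rw [eq_div_iff (by positivity), h1]
  have e2 : thetaQuot (4 * s) ^ 4 * (1 + thetaQuot (2 * s) ^ 2) ^ 2 =
      4 * thetaQuot (2 * s) ^ 2 := by
    linear_combination (thetaQuot (4 * s) ^ 2 * (1 + thetaQuot (2 * s) ^ 2) +
      2 * thetaQuot (2 * s)) * h2
  have e3 : thetaQuot (1 / (4 * s)) = (1 - thetaQuot s) / (1 + thetaQuot s) := by
    rw [eq_div_iff (by positivity), h3]
  rw [e1] at e2
  rw [e3]
  generalize thetaQuot s = u at *
  have e4 : thetaQuot (4 * s) ^ 4 = 8 * u * (1 + u ^ 2) / (1 + u) ^ 4 := by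
    rw [eq_div_iff (by positivity)]
    field_simp at e2
    have : (1 + u ^ 2) * (thetaQuot (4 * s) ^ 4 * (1 + u) ^ 4 - 8 * u * (1 + u ^ 2)) = 0 := by
      linear_combination (1 + u ^ 2) * e2
    rcases mul_eq_zero.1 this with h | h
    · nlinarith
    · linarith
  rw [e4, div_pow, ← add_div, div_eq_one_iff_eq (by positivity)]
  ring

theorem thetaQuot_one : thetaQuot 1 ^ 4 = 1 / 2 := by
  have h := thetaQuot_pow_four_add one_pos
  rw [div_one] at h
  linarith

/-- Legendre's equation √(kl) + √(k'l') = 1: `theta_cubic` divided by the product of the two θ₃. -/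
theorem thetaQuot_cubic {t : ℝ} (ht : 0 < t) :
    thetaQuot t * thetaQuot (3 * t) + thetaQuot (1 / t) * thetaQuot (1 / (3 * t)) = 1 := by
  obtain ⟨s, hs, rfl⟩ : ∃ s, 0 < s ∧ t = 4 * s := ⟨t / 4, by positivity, by ring⟩
  have hs3 : 0 < 3 * s := by linarith
  have h := theta_cubic hs
  have h1 := thetaQuot_inv_four hs
  have h3 := thetaQuot_inv_four hs3
  have a1 := thetaThree_add_thetaFour hs
  have a3 := thetaThree_add_thetaFour hs3
  rw [show 4 * (3 * s) = 3 * (4 * s) by ring] at h3 a3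
  rw [thetaFour_eq (show 0 < 4 * s by linarith), thetaFour_eq (show 0 < 3 * (4 * s) by linarith),
    thetaFour_eq hs, thetaFour_eq hs3] at h
  rw [thetaFour_eq hs] at a1
  rw [thetaFour_eq hs3] at a3
  have hf := (thetaThree_pos (show 0 < 4 * s by linarith))
  have hf3 := (thetaThree_pos (show 0 < 3 * (4 * s) by linarith))
  apply mul_right_cancel₀ (mul_pos hf hf3).ne'
  -- Classically θ₃ - θ₄ at `s` is 2θ₂ at `4 * s`, and the inverted quotient is θ₂/θ₃ there.
  have b1 : thetaThree s - thetaQuot s * thetaThree s =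
      2 * (thetaQuot (1 / (4 * s)) * thetaThree (4 * s)) := by
    linear_combination thetaQuot (1 / (4 * s)) * a1 - thetaThree s * h1
  have b3 : thetaThree (3 * s) - thetaQuot (3 * s) * thetaThree (3 * s) =
      2 * (thetaQuot (1 / (3 * (4 * s))) * thetaThree (3 * (4 * s))) := by
    linear_combination thetaQuot (1 / (3 * (4 * s))) * a3 - thetaThree (3 * s) * h3
  rw [b1, b3] at h
  linear_combination -h

/-- Squaring `theta_septic` lets θ₄(2t)² = θ₃(t)θ₄(t) bring the right side back to the arguments 4s
and 28s. -/
theorem thetaQuot_septic {t : ℝ} (ht : 0 < t) :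
    (1 + thetaQuot t * thetaQuot (7 * t) - thetaQuot (1 / t) * thetaQuot (1 / (7 * t))) ^ 2 =
      4 * (thetaQuot t * thetaQuot (7 * t)) := by
  obtain ⟨s, hs, rfl⟩ : ∃ s, 0 < s ∧ t = 4 * s := ⟨t / 4, by positivity, by ring⟩
  have hs7 : 0 < 7 * s := by linarith
  have h := theta_septic hs
  have h1 := thetaQuot_inv_four hs
  have h7 := thetaQuot_inv_four hs7
  have a1 := thetaThree_add_thetaFour hs
  have a7 := thetaThree_add_thetaFour hs7
  have m1 := thetaThree_mul_thetaFour (show 0 < 4 * s by linarith)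
  have m7 := thetaThree_mul_thetaFour (show 0 < 7 * (4 * s) by linarith)
  rw [show 4 * (7 * s) = 7 * (4 * s) by ring] at h7 a7
  rw [show 2 * (4 * s) = 8 * s by ring] at m1
  rw [show 2 * (7 * (4 * s)) = 7 * (8 * s) by ring] at m7
  rw [thetaFour_eq (show 0 < 4 * s by linarith)] at m1
  rw [thetaFour_eq (show 0 < 7 * (4 * s) by linarith)] at m7
  rw [thetaFour_eq (show 0 < 4 * s by linarith), thetaFour_eq (show 0 < 7 * (4 * s) by linarith),
    thetaFour_eq hs, thetaFour_eq hs7] at h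
  rw [thetaFour_eq hs] at a1
  rw [thetaFour_eq hs7] at a7
  have hf := (thetaThree_pos (show 0 < 4 * s by linarith))
  have hf7 := (thetaThree_pos (show 0 < 7 * (4 * s) by linarith))
  apply mul_right_cancel₀ (pow_pos (mul_pos hf hf7) 2).ne'
  have b1 : thetaThree s - thetaQuot s * thetaThree s =
      2 * (thetaQuot (1 / (4 * s)) * thetaThree (4 * s)) := by
    linear_combination thetaQuot (1 / (4 * s)) * a1 - thetaThree s * h1
  have b7 : thetaThree (7 * s) - thetaQuot (7 * s) * thetaThree (7 * s) =
      2 * (thetaQuot (1 / (7 * (4 * s))) * thetaThree (7 * (4 * s))) := by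
    linear_combination thetaQuot (1 / (7 * (4 * s))) * a7 - thetaThree (7 * s) * h7
  rw [b1, b7] at h
  rw [← mul_pow, show (1 + thetaQuot (4 * s) * thetaQuot (7 * (4 * s)) -
      thetaQuot (1 / (4 * s)) * thetaQuot (1 / (7 * (4 * s)))) *
      (thetaThree (4 * s) * thetaThree (7 * (4 * s))) =
      2 * (thetaFour (8 * s) * thetaFour (7 * (8 * s))) by linear_combination h, mul_pow, mul_pow,
    ← m1, ← m7]
  ring

/-! ### A_{4,n} in terms of the quotient. -/

theorem paramA_four_eq_thetaQuot {n : ℝ} (hn : 0 < n) :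
    paramA 4 n = √2 * thetaQuot (√(n / 4)) / (1 - thetaQuot (√(n / 4))) := by
  have ht : 0 < √(n / 4) := Real.sqrt_pos.2 (by positivity)
  have hf := thetaThree_pos ht
  rw [paramA_four n hn, thetaFour_eq ht, ← mul_assoc, ← one_sub_mul,
    mul_div_mul_right _ _ hf.ne']

theorem paramA_four_pos {n : ℝ} (hn : 0 < n) : 0 < paramA 4 n := by
  have ht : 0 < √(n / 4) := Real.sqrt_pos.2 (by positivity)
  have := thetaQuot_pos ht
  have := sub_pos.2 (thetaQuot_lt_one ht)
  rw [paramA_four_eq_thetaQuot hn]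
  positivity

/-- `A_{4,n}` is determined by the square of the theta quotient at `√n`. -/
theorem paramA_four_eq_of_quadratic {n A : ℝ} (hn : 0 < n) (hA : 0 < A)
    (h : (A ^ 2 + √2 * A) * (1 - thetaQuot (√n) ^ 2) = thetaQuot (√n) ^ 2) :
    paramA 4 n = A := by
  have ht : 0 < √(n / 4) := Real.sqrt_pos.2 (by positivity)
  have hB := paramA_four_pos hn
  have hu := thetaQuot_pos ht
  have hu1 := sub_pos.2 (thetaQuot_lt_one ht)
  have hd := thetaQuot_two_mul ht
  have e : 2 * √(n / 4) = √n := by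
    rw [Real.sqrt_div' _ (by norm_num), show (4 : ℝ) = 2 ^ 2 by norm_num,
      Real.sqrt_sq (by norm_num)]
    ring
  rw [e] at hd
  have hc : 0 < 1 - thetaQuot (√n) ^ 2 := by
    have hp := thetaQuot_pos (Real.sqrt_pos.2 hn)
    nlinarith [thetaQuot_lt_one (Real.sqrt_pos.2 hn)]
  have hs : √2 ^ 2 = 2 := Real.sq_sqrt (by norm_num)
  have hs0 : 0 < √2 := by positivity
  have h' : (paramA 4 n ^ 2 + √2 * paramA 4 n) * (1 - thetaQuot (√n) ^ 2) =
      thetaQuot (√n) ^ 2 := by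
    rw [paramA_four_eq_thetaQuot hn]
    generalize thetaQuot (√(n / 4)) = u at *
    generalize thetaQuot (√n) = c at *
    field_simp
    rw [hs]
    have hu2 : (1 + u ^ 2) ≠ 0 := by positivity
    apply mul_right_cancel₀ hu2
    linear_combination (-(2 * u) - (1 - u) ^ 2) * hd
  -- Both numbers are positive and give X² + √2 X the same value, so the second factor is positive.
  have h2 : (paramA 4 n - A) * (paramA 4 n + A + √2) = 0 := by
    apply mul_right_cancel₀ hc.ne'
    linear_combination h' - h
  rcases mul_eq_zero.1 h2 with h3 | h3
  · linarith
  · linarith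

/-- `A_{4,n}` as a sum of two square roots, in terms of the squared theta quotient. -/
theorem paramA_four_eq_sqrt_add_sqrt {n v M P : ℝ} (hn : 0 < n)
    (hv : thetaQuot (√(n / 4)) ^ 2 = v) (hM : M * (1 - v) ^ 2 = 2 * v ^ 2)
    (hP : P * (1 - v) ^ 2 = 2 * v) : paramA 4 n = √M + √P := by
  have ht : 0 < √(n / 4) := Real.sqrt_pos.2 (by positivity)
  rw [paramA_four_eq_thetaQuot hn]
  have hu := thetaQuot_pos ht
  have hu1 := sub_pos.2 (thetaQuot_lt_one ht)
  generalize thetaQuot (√(n / 4)) = u at *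
  subst hv
  have hs : √2 ^ 2 = 2 := Real.sq_sqrt (by norm_num)
  have h1 : 0 < 1 - u ^ 2 := by nlinarith
  -- The two radicals are the halves of √2·u(1 + u)/(1 - u²) = √2·u/(1 - u).
  have eM : √M = √2 * u ^ 2 / (1 - u ^ 2) := by
    rw [Real.sqrt_eq_iff_mul_self_eq_of_pos (by positivity), ← sq, div_pow, mul_pow, hs,
      div_eq_iff (by positivity), hM]
  have eP : √P = √2 * u / (1 - u ^ 2) := by
    rw [Real.sqrt_eq_iff_mul_self_eq_of_pos (by positivity), ← sq, div_pow, mul_pow, hs,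
      div_eq_iff (by positivity), hP]
  rw [eM, eP]
  have h2 : 1 - u ^ 2 = (1 - u) * (1 + u) := by ring
  rw [h2]
  field_simp
  ring

/-! ### Special values of the quotient. -/

theorem thetaQuot_sq_of_two_mul_eq_inv {t : ℝ} (ht : 0 < t) (h : 2 * t = 1 / t) :
    thetaQuot t ^ 2 = √2 - 1 := by
  have h1 := thetaQuot_two_mul ht
  have h2 := thetaQuot_pow_four_add ht
  rw [← h] at h2
  have hu := thetaQuot_pos ht
  generalize thetaQuot t = u at *
  generalize thetaQuot (2 * t) = w at *
  have h3 : (1 + u ^ 4) * ((u ^ 2 + 1) ^ 2 - 2) = 0 := by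
    linear_combination (1 + u ^ 2) ^ 2 * h2 - (w ^ 2 * (1 + u ^ 2) + 2 * u) * h1
  have h4 : (u ^ 2 + 1) ^ 2 = 2 := by
    rcases mul_eq_zero.1 h3 with h | h
    · exact absurd h (by positivity)
    · linarith
  rw [← h4, Real.sqrt_sq (by positivity)]
  ring

theorem thetaQuot_inv_sqrt_two_sq : thetaQuot (1 / √2) ^ 2 = √2 - 1 := by
  have hs : √2 ^ 2 = 2 := Real.sq_sqrt (by norm_num)
  refine thetaQuot_sq_of_two_mul_eq_inv (by positivity) ?_
  field_simp
  exact hs.symm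

theorem thetaQuot_sqrt_two_sq : thetaQuot (√2) ^ 2 = (2 - √2) * √(1 + √2) := by
  have hs : √2 ^ 2 = 2 := Real.sq_sqrt (by norm_num)
  have ha : √(1 + √2) ^ 2 = 1 + √2 := Real.sq_sqrt (by positivity)
  have h0 : (0 : ℝ) < 1 / √2 := by positivity
  have h1 := thetaQuot_two_mul h0
  have h2 := thetaQuot_inv_sqrt_two_sq
  have hu := thetaQuot_pos h0
  have e : 2 * (1 / √2) = √2 := by field_simp; exact hs.symm
  rw [e, h2] at h1
  have h3 : thetaQuot (1 / √2) = (√2 - 1) * √(1 + √2) := by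
    have h1' : 1 < √2 := Real.lt_sqrt_of_sq_lt (by norm_num)
    have : 0 ≤ (√2 - 1) * √(1 + √2) := mul_nonneg (by linarith) (Real.sqrt_nonneg _)
    rw [← sq_eq_sq₀ hu.le this, h2]
    grind
  rw [h3] at h1
  grind

theorem thetaQuot_sqrt_three_sq : thetaQuot (√3) ^ 2 = √2 * (1 + √3) / 4 := by
  have hs : √2 ^ 2 = 2 := Real.sq_sqrt (by norm_num)
  have h3 : √3 ^ 2 = 3 := Real.sq_sqrt (by norm_num)
  have h0 : (0 : ℝ) < 1 / √3 := by positivity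
  have hc := thetaQuot_cubic h0
  have hj := thetaQuot_pow_four_add h0
  have e1 : 3 * (1 / √3) = √3 := by field_simp; exact h3.symm
  have e2 : 1 / (1 / √3) = √3 := by simp
  rw [e1, e2] at hc
  rw [e2] at hj
  have h1 : 1 < √3 := Real.lt_sqrt_of_sq_lt (by norm_num)
  have h2 : √3 < 2 := by rw [Real.sqrt_lt' (by norm_num)]; norm_num
  have hb := four_fifths_le_thetaQuot h1.le
  generalize thetaQuot (√3) = u at *
  generalize thetaQuot (1 / √3) = w at *
  -- From 2uw = 1 and u⁴ + w⁴ = 1: u⁴ and w⁴ have sum 1 and product 1/16.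
  have hp : (u ^ 4 - (2 + √3) / 4) * (u ^ 4 - (2 - √3) / 4) = 0 := by grind
  have hu : (4 / 5 : ℝ) ^ 4 ≤ u ^ 4 := by gcongr
  have h4 : u ^ 4 = (2 + √3) / 4 := by
    rcases mul_eq_zero.1 hp with h | h
    · linarith
    · have : (1.7 : ℝ) < √3 := Real.lt_sqrt_of_sq_lt (by norm_num)
      norm_num at hu
      linarith
  rw [← sq_eq_sq₀ (by positivity) (by positivity)]
  grind

theorem thetaQuot_sqrt_seven_sq : thetaQuot (√7) ^ 2 = √2 * (3 + √7) / 8 := by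
  have hs : √2 ^ 2 = 2 := Real.sq_sqrt (by norm_num)
  have h7 : √7 ^ 2 = 7 := Real.sq_sqrt (by norm_num)
  have h0 : (0 : ℝ) < 1 / √7 := by positivity
  have hc := thetaQuot_septic h0
  have hj := thetaQuot_pow_four_add h0
  have e1 : 7 * (1 / √7) = √7 := by field_simp; exact h7.symm
  have e2 : 1 / (1 / √7) = √7 := by simp
  rw [e1, e2] at hc
  rw [e2] at hj
  have h1 : 2.6 < √7 := Real.lt_sqrt_of_sq_lt (by norm_num)
  have hb := four_fifths_le_thetaQuot (show 1 ≤ √7 by linarith)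
  generalize thetaQuot (√7) = u at *
  generalize thetaQuot (1 / √7) = w at *
  -- At t = 1/√7 the two products in the modular equation coincide and cancel.
  have huw : u * w = 1 / 4 := by linarith
  have hp : (u ^ 4 - (8 + 3 * √7) / 16) * (u ^ 4 - (8 - 3 * √7) / 16) = 0 := by
    have : u ^ 4 * w ^ 4 = (1 / 4) ^ 4 := by rw [← huw]; ring
    have hw : w ^ 4 = 1 - u ^ 4 := by linarith
    rw [hw] at this
    linear_combination (-1) * this - 9 / 256 * h7
  -- The conjugate root is below 0.4096, so the lower bound excludes it.
  have hu : (4 / 5 : ℝ) ^ 4 ≤ u ^ 4 := by gcongr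
  have h4 : u ^ 4 = (8 + 3 * √7) / 16 := by
    rcases mul_eq_zero.1 hp with h | h
    · linarith
    · norm_num at hu
      linarith
  rw [← sq_eq_sq₀ (by positivity) (by positivity)]
  grind

theorem thetaQuot_one_sq : thetaQuot 1 ^ 2 = √2 / 2 := by
  have hs : √2 ^ 2 = 2 := Real.sq_sqrt (by norm_num)
  rw [← sq_eq_sq₀ (by positivity) (by positivity)]
  linear_combination thetaQuot_one - hs / 4

theorem thetaQuot_three_sq : thetaQuot 3 ^ 2 = (√3 - 1) * (√2 + √(√3)) / 2 := by
  have hs : √2 ^ 2 = 2 := Real.sq_sqrt (by norm_num)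
  have h3 : √3 ^ 2 = 3 := Real.sq_sqrt (by norm_num)
  have hF : √(√3) ^ 2 = √3 := Real.sq_sqrt (by positivity)
  have hc := thetaQuot_cubic one_pos
  have hj := thetaQuot_pow_four_add (show (0 : ℝ) < 3 by norm_num)
  have hU := thetaQuot_one_sq
  have hb := four_fifths_le_thetaQuot (show (1 : ℝ) ≤ 3 by norm_num)
  rw [mul_one, div_one] at hc
  have h2l : 1.41 < √2 := Real.lt_sqrt_of_sq_lt (by norm_num)
  have h2u : √2 < 1.42 := by rw [Real.sqrt_lt' (by norm_num)]; norm_num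
  have h3l : 1.73 < √3 := Real.lt_sqrt_of_sq_lt (by norm_num)
  have h3u : √3 < 1.74 := by rw [Real.sqrt_lt' (by norm_num)]; norm_num
  have hFl : 1.3 < √(√3) := Real.lt_sqrt_of_sq_lt (by linarith)
  generalize √(√3) = F at *
  generalize √3 = r3 at *
  generalize √2 = r2 at *
  generalize thetaQuot 1 = U at *
  generalize thetaQuot 3 = y at *
  generalize thetaQuot (1 / 3) = x at *
  -- The cubic equation at t = 1 reads U(x + y) = 1; with x⁴ + y⁴ = 1 it gives a quadratic for xy.
  have hsum : (x + y) ^ 2 = r2 := by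
    have : U ^ 2 * (x + y) ^ 2 = 1 := by rw [← mul_pow, ← one_pow 2]; congr 1; linarith
    rw [hU] at this
    linear_combination r2 * this - (x + y) ^ 2 / 2 * hs
  have hp : (x * y - (r2 - r2 * r3 / 2)) * (x * y - (r2 + r2 * r3 / 2)) = 0 := by
    have h5 : (r2 - 2 * (x * y)) ^ 2 - 2 * (x * y) ^ 2 = 1 := by
      rw [← hj, ← hsum]; ring
    linear_combination h5 / 2 - hs / 2 + hs - r2 ^ 2 / 4 * h3 - 3 / 4 * hs
  have hpv : x * y = r2 - r2 * r3 / 2 := by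
    rcases mul_eq_zero.1 hp with h | h
    · linarith
    -- The larger root would violate 4xy ≤ (x + y)² = √2.
    · nlinarith [sq_nonneg (x - y)]
  have hx2 : x ^ 2 = r2 - 2 * (x * y) - y ^ 2 := by rw [← hsum]; ring
  have hq : (y ^ 2 - (r3 - 1) * (r2 + F) / 2) * (y ^ 2 - (r3 - 1) * (r2 - F) / 2) = 0 := by
    have h6 : x ^ 2 * y ^ 2 = (r2 - r2 * r3 / 2) ^ 2 := by rw [← hpv]; ring
    rw [hx2, hpv] at h6
    grind
  rcases mul_eq_zero.1 hq with h | h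
  · linarith
  · nlinarith

/-! ### The eight evaluations. -/

theorem sqrt_six : √6 = √2 * √3 := by
  rw [← Real.sqrt_mul (by norm_num)]; norm_num

theorem sqrt_fourteen : √14 = √2 * √7 := by
  rw [← Real.sqrt_mul (by norm_num)]; norm_num

theorem paramA_four_two : paramA 4 2 = 1 + √(1 + √2) := by
  have hs : √2 ^ 2 = 2 := Real.sq_sqrt (by norm_num)
  have ht : √(2 / 4 : ℝ) = 1 / √2 := by
    rw [← Real.sqrt_one, ← Real.sqrt_div (by norm_num)]; norm_num
  rw [paramA_four_eq_sqrt_add_sqrt (M := 1) (P := 1 + √2) two_pos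
    (by rw [ht, thetaQuot_inv_sqrt_two_sq]) (by grind) (by grind), Real.sqrt_one]

theorem paramA_four_three : paramA 4 3 = (1 + √2) * (1 + √3) / √2 := by
  have hs : √2 ^ 2 = 2 := Real.sq_sqrt (by norm_num)
  have h3 : √3 ^ 2 = 3 := Real.sq_sqrt (by norm_num)
  refine paramA_four_eq_of_quadratic (by norm_num) (by positivity) ?_
  rw [thetaQuot_sqrt_three_sq, show (1 + √2) * (1 + √3) / √2 = (1 + √2) * (1 + √3) * √2 / 2 by
    field_simp; rw [hs]]
  grind

theorem paramA_four_four : paramA 4 4 = √(8 + 6 * √2) + √(6 + 4 * √2) := by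
  have hs : √2 ^ 2 = 2 := Real.sq_sqrt (by norm_num)
  -- The stated order of the radicals is opposite to that of M and P.
  rw [add_comm]
  refine paramA_four_eq_sqrt_add_sqrt (by norm_num)
    (by rw [div_self (by norm_num), Real.sqrt_one, thetaQuot_one_sq]) ?_ ?_ <;> grind

theorem paramA_four_seven : paramA 4 7 = (3 + √7) * (4 + √14) / 2 := by
  have hs : √2 ^ 2 = 2 := Real.sq_sqrt (by norm_num)
  have h7 : √7 ^ 2 = 7 := Real.sq_sqrt (by norm_num)
  refine paramA_four_eq_of_quadratic (by norm_num) (by positivity) ?_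
  rw [thetaQuot_sqrt_seven_sq, sqrt_fourteen]
  grind

theorem paramA_four_eight : paramA 4 8 =
    √(52 + 36 * √2 + (32 + 24 * √2) * √(1 + √2)) +
      √(56 + 40 * √2 + (36 + 26 * √2) * √(1 + √2)) := by
  have hs : √2 ^ 2 = 2 := Real.sq_sqrt (by norm_num)
  have ha : √(1 + √2) ^ 2 = 1 + √2 := Real.sq_sqrt (by positivity)
  refine paramA_four_eq_sqrt_add_sqrt (by norm_num)
    (by rw [show (8 / 4 : ℝ) = 2 by norm_num, thetaQuot_sqrt_two_sq]) ?_ ?_ <;> grind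

theorem paramA_four_twelve : paramA 4 12 =
    √(402 + 232 * √3 + 284 * √2 + 164 * √6) +
      √(416 + 240 * √3 + 294 * √2 + 170 * √6) := by
  have hs : √2 ^ 2 = 2 := Real.sq_sqrt (by norm_num)
  have h3 : √3 ^ 2 = 3 := Real.sq_sqrt (by norm_num)
  rw [sqrt_six]
  refine paramA_four_eq_sqrt_add_sqrt (by norm_num)
    (by rw [show (12 / 4 : ℝ) = 3 by norm_num, thetaQuot_sqrt_three_sq]) ?_ ?_ <;> grind

theorem paramA_four_twentyEight : paramA 4 28 =
    √(2 * (64641 + 17276 * √14 + 24432 * √7 + 45708 * √2)) +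
      2 * √(32384 + 22899 * √2 + 12240 * √7 + 8655 * √14) := by
  have hs : √2 ^ 2 = 2 := Real.sq_sqrt (by norm_num)
  have h7 : √7 ^ 2 = 7 := Real.sq_sqrt (by norm_num)
  have e : 2 * √(32384 + 22899 * √2 + 12240 * √7 + 8655 * √14) =
      √(2 ^ 2 * (32384 + 22899 * √2 + 12240 * √7 + 8655 * √14)) := by
    rw [Real.sqrt_mul (by norm_num), Real.sqrt_sq (by norm_num)]
  rw [e, sqrt_fourteen]
  refine paramA_four_eq_sqrt_add_sqrt (by norm_num)
    (by rw [show (28 / 4 : ℝ) = 7 by norm_num, thetaQuot_sqrt_seven_sq]) ?_ ?_ <;> grind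

theorem paramA_four_nine : paramA 4 9 =
    √(94 + 66 * √2 + 38 * √6 + 54 * √3) + √(93 + 66 * √2 + 38 * √6 + 54 * √3) := by
  have hs : √2 ^ 2 = 2 := Real.sq_sqrt (by norm_num)
  have h3 : √3 ^ 2 = 3 := Real.sq_sqrt (by norm_num)
  have hF : √(√3) ^ 2 = √3 := Real.sq_sqrt (by positivity)
  -- The first radical denests over √2 and √3, the second only after adjoining the fourth root of 3,
  -- which already occurs in the quotient at 3.
  have e1 : √(94 + 66 * √2 + 38 * √6 + 54 * √3) = 5 + 3 * √2 + √3 * (3 + 2 * √2) := by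
    rw [sqrt_six, Real.sqrt_eq_iff_mul_self_eq_of_pos (by positivity)]
    grind
  have e2 : √(93 + 66 * √2 + 38 * √6 + 54 * √3) =
      √(√3) * √2 * (5 + 4 * √2 + √3 * (3 + 2 * √2)) / 2 := by
    rw [sqrt_six, Real.sqrt_eq_iff_mul_self_eq_of_pos (by positivity)]
    grind
  rw [e1, e2]
  refine paramA_four_eq_of_quadratic (by norm_num) (by positivity) ?_
  rw [show √9 = (3 : ℝ) by rw [show (9 : ℝ) = 3 ^ 2 by norm_num, Real.sqrt_sq (by norm_num)],
    thetaQuot_three_sq]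
  grind

theorem mainTheorem2 :
    paramA 4 2 = 1 + √(1 + √2) ∧
    paramA 4 3 = (1 + √2) * (1 + √3) / √2 ∧
    paramA 4 4 = √(8 + 6 * √2) + √(6 + 4 * √2) ∧
    paramA 4 7 = (3 + √7) * (4 + √14) / 2 ∧
    paramA 4 8 =
      √(52 + 36 * √2 + (32 + 24 * √2) * √(1 + √2)) +
        √(56 + 40 * √2 + (36 + 26 * √2) * √(1 + √2)) ∧
    paramA 4 9 =
      √(94 + 66 * √2 + 38 * √6 + 54 * √3) + √(93 + 66 * √2 + 38 * √6 + 54 * √3) ∧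
    paramA 4 12 =
      √(402 + 232 * √3 + 284 * √2 + 164 * √6) + √(416 + 240 * √3 + 294 * √2 + 170 * √6) ∧
    paramA 4 28 =
      √(2 * (64641 + 17276 * √14 + 24432 * √7 + 45708 * √2)) +
        2 * √(32384 + 22899 * √2 + 12240 * √7 + 8655 * √14) :=
  ⟨paramA_four_two, paramA_four_three, paramA_four_four, paramA_four_seven, paramA_four_eight,
    paramA_four_nine, paramA_four_twelve, paramA_four_twentyEight⟩
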